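/- Conventions: $x^y=y^{-1}xy$, $[x,y]=x^{-1}y^{-1}xy$; $q\ge 0$ is an integer. For a group $G$, let $G^\varphi$ be an isomorphic copy of $G$ via $g\mapsto g^\varphi$, and let $\widehat{\mathcal G}=\{\widehat k: k\in G\}$ be a set of symbols, one for each element of $G$, if $q\ge1$, and $\widehat{\mathcal G}=\emptyset$ if $q=0$. *The group $\nu^q(G)$.* Let $\nu(G)$ be the quotient of the free product $G*G^\varphi$ by the relations $[g,h^\varphi]^k=[g^k,(h^k)^\varphi]=[g,h^\varphi]^{k^\varphi}$ for $g,h,k\in G$. Then $\nu^q(G)$ is the quotient of $\nu(G)*F(\widehat{\mathcal G})$ (with $F(\widehat{\mathcal G})$ the free group on $\widehat{\mathcal G}$) by the following relations for all $g,h,k,k_1\in G$ if $q\ge1$, and by no further relations if $q=0$: $$g^{-1}\widehat k\,g=\widehat{k^g},\qquad (g^\varphi)^{-1}\widehat k\,g^\varphi=\widehat{k^g},\qquad \widehat k^{-1}[g,h^\varphi]\widehat k=[g^{k^q},(h^{k^q})^\varphi],$$ $$\widehat k^{-1}\,\widehat{kk_1}\,\widehat{k_1}^{-1}=\prod_{i=1}^{q-1}[k,(k_1^{-i})^\varphi]^{k^{q-1-i}},\qquad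 [\widehat k,\widehat{k_1}]=[k^q,(k_1^q)^\varphi],\qquad \widehat{[g,h]}=[g,h^\varphi]^q.$$ *The $q$-exterior square.* $G\otimes^qG$ is the group generated by symbols $g\otimes h$ ($g,h\in G$) and the elements of $\widehat{\mathcal G}$, with relations $$g\otimes hh_1=(g\otimes h_1)(g^{h_1}\otimes h^{h_1}),\qquad gg_1\otimes h=(g^{g_1}\otimes h^{g_1})(g_1\otimes h)$$ and, if $q\ge1$, $$(g\otimes h)^{\widehat k}=g^{k^q}\otimes h^{k^q},\qquad \widehat{kk_1}=\widehat k\prod_{i=1}^{q-1}\Big(k^{k^{q-1-i}}\otimes(k_1^{-i})^{k^{q-1-i}}\Big)\widehat{k_1},$$ $$[\widehat k,\widehat{k_1}]=k^q\otimes k_1^q,\qquad \widehat{[g,h]}=(g\otimes h)^q,$$ and $G\wedge^qG$ is the quotient of $G\otimes^qG$ by the normal subgroup generated by all $g\otimes g$; the image of $g\otimes h$ is written $g\wedge h$. Each $x\in G$ acts on $G\wedge^qG$ by $(g\wedge h)^x=g^x\wedge h^x$, $\widehat k^{\,x}=\widehat{k^x}$. *Polycyclic presentations.* A polycyclic presentation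 in generators $x_1,\dots,x_n$ with index set $I\subseteq\{1,\dots,n\}$ consists of the relations $x_i^{e_i}=x_{i+1}^{\alpha_{i,i+1}}\cdots x_n^{\alpha_{i,n}}$ for $i\in I$; $x_j^{-1}x_ix_j=x_{j+1}^{\beta_{i,j,j+1}}\cdots x_n^{\beta_{i,j,n}}$ for $j<i$; and $x_jx_ix_j^{-1}=x_{j+1}^{\gamma_{i,j,j+1}}\cdots x_n^{\gamma_{i,j,n}}$ for $j<i$, $j\notin I$, where the $e_i$ are positive integers and the other exponents are integers. It is consistent if every element of the presented group is $x_1^{a_1}\cdots x_n^{a_n}$ for exactly one $a\in\mathbb Z^n$ with $0\le a_i<e_i$ for all $i\in I$. **Theorem.** Let $G$ be a (polycyclic) group given by a consistent polycyclic presentation with generators $g_1,\dots,g_n$, relators $r_1,\dots,r_l$ and index set $I$, and let $G\wedge^qG$ be given by a consistent polycyclic presentation with generators $w_1,\dots,w_r$ and relators $u_1,\dots,u_s$. Suppose that $G$ is $q$-perfect, that is, $G=G'G^q$, where $G^q$ is the subgroup generated by all $q$-th powers. Let $\tau^q(G)$ be the group generated by $g_1,\dots,g_n,g_1^\varphi,\dots,g_n^\varphi,w_1,\dots,w_r$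 with defining relations 1. $r_i(g_1,\dots,g_n)=1$ for $1\le i\le l$; 2. $r_i(g_1^\varphi,\dots,g_n^\varphi)=1$ for $1\le i\le l$; 3. $u_i(w_1,\dots,w_r)=1$ for $1\le i\le s$; 4. $g_i^{-1}g_j^\varphi g_i=g_j^\varphi\,(g_i\wedge g_j)^{-1}$ for $1\le i,j\le n$, and $g_ig_j^\varphi g_i^{-1}=g_j^\varphi\,(g_i^{-1}\wedge g_j)^{-1}$ for $1\le i,j\le n$, $i\notin I$; 5. for $1\le i\le r$, $1\le j\le n$: $g_j^{-1}w_ig_j=w_i^{g_j}$ and $(g_j^\varphi)^{-1}w_ig_j^\varphi=w_i^{g_j}$, and, if $j\notin I$, $g_jw_ig_j^{-1}=w_i^{g_j^{-1}}$ and $g_j^\varphi w_i(g_j^\varphi)^{-1}=w_i^{g_j^{-1}}$; where in (4) and (5) the elements $g_i^{\pm1}\wedge g_j$ and $w_i^{g_j^{\pm1}}$ of $G\wedge^qG$ are written as words in $w_1,\dots,w_r$, by an arbitrary choice, for each element of $G\wedge^qG$, of a word that expresses it. Then this is a presentation of $\nu^q(G)$: there is an isomorphism $\tau^q(G)\to\nu^q(G)$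 with $g_i\mapsto g_i$ and $g_i^\varphi\mapsto g_i^\varphi$, under which every word in $w_1,\dots,w_r$ that expresses $a\wedge b$ in $G\wedge^qG$ is sent to $[a,b^\varphi]$, and every word that expresses $\widehat k$ is sent to $\widehat k$ (for all $a,b,k\in G$). -/

import Mathlib

namespace QTensor

universe u

/-- Right conjugation `y ^ x = x⁻¹ y x`. -/
def conj {G : Type u} [Group G] (y x : G) : G := x⁻¹ * y * x

/-- The commutator `[x, y] = x⁻¹ y⁻¹ x y`. -/
def comm {G : Type u} [Group G] (x y : G) : G := x⁻¹ * y⁻¹ * x * y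

/-- `G` is `q`-perfect: `G = G' G^q`, where `G^q` is the subgroup generated by the `q`-th powers. -/
def IsQPerfect (q : ℕ) (G : Type u) [Group G] : Prop :=
  commutator G ⊔ Subgroup.closure (Set.range fun g : G => g ^ q) = ⊤

/-- The set of symbols `k̂`, one for each `k` in `G` if `1 ≤ q`, and empty if `q = 0`. -/
structure Hat (q : ℕ) (G : Type u) where
  pos : 1 ≤ q
  elt : G

/-! ### The group `ν(G)` -/

/-- The relators `[g, h^φ]^k [g^k, (h^k)^φ]⁻¹` and `[g, h^φ]^(k^φ) [g^k, (h^k)^φ]⁻¹` of `ν(G)`,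
in the free product of `G` (left factor) and its copy `G^φ` (right factor). -/
inductive NuRel (G : Type u) [Group G] : Monoid.Coprod G G → Prop
  | left (g h k : G) : NuRel G
      (conj (comm (Monoid.Coprod.inl g) (Monoid.Coprod.inr h)) (Monoid.Coprod.inl k) *
        (comm (Monoid.Coprod.inl (conj g k)) (Monoid.Coprod.inr (conj h k)))⁻¹)
  | right (g h k : G) : NuRel G
      (conj (comm (Monoid.Coprod.inl g) (Monoid.Coprod.inr h)) (Monoid.Coprod.inr k) *
        (comm (Monoid.Coprod.inl (conj g k)) (Monoid.Coprod.inr (conj h k)))⁻¹)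

/-- The group `ν(G)`. -/
abbrev Nu (G : Type u) [Group G] : Type u :=
  Monoid.Coprod G G ⧸ Subgroup.normalClosure {x | NuRel G x}

/-! ### The group `ν^q(G)` -/

/-- The free product of `ν(G)` and the free group on the symbols `k̂`. -/
abbrev NuHat (q : ℕ) (G : Type u) [Group G] : Type u :=
  Monoid.Coprod (Nu G) (FreeGroup (Hat q G))

namespace NuHat

/-- The element `g` of `ν(G) * F(Ĝ)`. -/
def left (q : ℕ) {G : Type u} [Group G] : G →* NuHat q G :=
  Monoid.Coprod.inl.comp ((QuotientGroup.mk' _).comp Monoid.Coprod.inl)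

/-- The element `g^φ` of `ν(G) * F(Ĝ)`. -/
def right (q : ℕ) {G : Type u} [Group G] : G →* NuHat q G :=
  Monoid.Coprod.inl.comp ((QuotientGroup.mk' _).comp Monoid.Coprod.inr)

/-- The element `k̂` of `ν(G) * F(Ĝ)`. -/
def hat {q : ℕ} {G : Type u} [Group G] (hq : 1 ≤ q) (k : G) : NuHat q G :=
  Monoid.Coprod.inr (FreeGroup.of ⟨hq, k⟩)

end NuHat

/-- The relators of `ν^q(G)` in `ν(G) * F(Ĝ)`; there are none if `q = 0`. -/
inductive NuQRel (q : ℕ) (G : Type u) [Group G] : NuHat q G → Prop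
  | conj_left (hq : 1 ≤ q) (g k : G) : NuQRel q G
      ((NuHat.left q g)⁻¹ * NuHat.hat hq k * NuHat.left q g * (NuHat.hat hq (conj k g))⁻¹)
  | conj_right (hq : 1 ≤ q) (g k : G) : NuQRel q G
      ((NuHat.right q g)⁻¹ * NuHat.hat hq k * NuHat.right q g * (NuHat.hat hq (conj k g))⁻¹)
  | conj_hat (hq : 1 ≤ q) (g h k : G) : NuQRel q G
      ((NuHat.hat hq k)⁻¹ * comm (NuHat.left q g) (NuHat.right q h) * NuHat.hat hq k *
        (comm (NuHat.left q (conj g (k ^ q))) (NuHat.right q (conj h (k ^ q))))⁻¹)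
  | hat_mul (hq : 1 ≤ q) (k k₁ : G) : NuQRel q G
      ((NuHat.hat hq k)⁻¹ * NuHat.hat hq (k * k₁) * (NuHat.hat hq k₁)⁻¹ *
        ((List.range' 1 (q - 1)).map fun i =>
          conj (comm (NuHat.left q k) (NuHat.right q (k₁⁻¹ ^ i)))
            (NuHat.left q (k ^ (q - 1 - i)))).prod⁻¹)
  | hat_comm (hq : 1 ≤ q) (k k₁ : G) : NuQRel q G
      (comm (NuHat.hat hq k) (NuHat.hat hq k₁) *
        (comm (NuHat.left q (k ^ q)) (NuHat.right q (k₁ ^ q)))⁻¹)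
  | comm_hat (hq : 1 ≤ q) (g h : G) : NuQRel q G
      (NuHat.hat hq (comm g h) * ((comm (NuHat.left q g) (NuHat.right q h)) ^ q)⁻¹)

/-- The group `ν^q(G)`. -/
abbrev NuQ (q : ℕ) (G : Type u) [Group G] : Type u :=
  NuHat q G ⧸ Subgroup.normalClosure {x | NuQRel q G x}

namespace NuQ

/-- The natural map `G → ν^q(G)`, `g ↦ g`. -/
def left (q : ℕ) {G : Type u} [Group G] : G →* NuQ q G :=
  (QuotientGroup.mk' _).comp (NuHat.left q)

/-- The natural map `G → ν^q(G)`, `g ↦ g^φ`. -/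
def right (q : ℕ) {G : Type u} [Group G] : G →* NuQ q G :=
  (QuotientGroup.mk' _).comp (NuHat.right q)

/-- The element `k̂` of `ν^q(G)`. -/
def hat {q : ℕ} {G : Type u} [Group G] (hq : 1 ≤ q) (k : G) : NuQ q G :=
  QuotientGroup.mk' _ (NuHat.hat hq k)

end NuQ

/-! ### The `q`-tensor square and the `q`-exterior square -/

/-- Free generators `g ⊗ h` and `k̂` for the `q`-tensor square. -/
abbrev TensorGen (q : ℕ) (G : Type u) : Type u := (G × G) ⊕ Hat q G

/-- The symbol `g ⊗ h`. -/
def symT (q : ℕ) {G : Type u} (g h : G) : FreeGroup (TensorGen q G) := FreeGroup.of (Sum.inl (g, h))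

/-- The symbol `k̂`. -/
def symH {q : ℕ} {G : Type u} (hq : 1 ≤ q) (k : G) : FreeGroup (TensorGen q G) :=
  FreeGroup.of (Sum.inr ⟨hq, k⟩)

/-- The relators of the `q`-tensor square `G ⊗^q G`; only the first two kinds occur if `q = 0`. -/
inductive TensorRel (q : ℕ) (G : Type u) [Group G] : FreeGroup (TensorGen q G) → Prop
  | mul_right (g h h₁ : G) : TensorRel q G
      (symT q g (h * h₁) * (symT q g h₁ * symT q (conj g h₁) (conj h h₁))⁻¹)
  | mul_left (g g₁ h : G) : TensorRel q G
      (symT q (g * g₁) h * (symT q (conj g g₁) (conj h g₁) * symT q g₁ h)⁻¹)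
  | conj_hat (hq : 1 ≤ q) (g h k : G) : TensorRel q G
      (conj (symT q g h) (symH hq k) * (symT q (conj g (k ^ q)) (conj h (k ^ q)))⁻¹)
  | hat_mul (hq : 1 ≤ q) (k k₁ : G) : TensorRel q G
      (symH hq (k * k₁) * (symH hq k *
        ((List.range' 1 (q - 1)).map fun i =>
          symT q (conj k (k ^ (q - 1 - i))) (conj (k₁⁻¹ ^ i) (k ^ (q - 1 - i)))).prod *
        symH hq k₁)⁻¹)
  | hat_comm (hq : 1 ≤ q) (k k₁ : G) : TensorRel q G
      (comm (symH hq k) (symH hq k₁) * (symT q (k ^ q) (k₁ ^ q))⁻¹)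
  | comm_hat (hq : 1 ≤ q) (g h : G) : TensorRel q G
      (symH hq (comm g h) * ((symT q g h) ^ q)⁻¹)

/-- The `q`-tensor square `G ⊗^q G`. -/
abbrev TensorSq (q : ℕ) (G : Type u) [Group G] : Type u :=
  PresentedGroup {x | TensorRel q G x}

namespace TensorSq

/-- The element `g ⊗ h`. -/
def tmul (q : ℕ) {G : Type u} [Group G] (g h : G) : TensorSq q G :=
  PresentedGroup.mk _ (symT q g h)

/-- The element `k̂`. -/
def hat {q : ℕ} {G : Type u} [Group G] (hq : 1 ≤ q) (k : G) : TensorSq q G :=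
  PresentedGroup.mk _ (symH hq k)

end TensorSq

/-- The `q`-exterior square `G ∧^q G`: the quotient of `G ⊗^q G` by the normal subgroup
generated by all `g ⊗ g`. -/
abbrev ExtSq (q : ℕ) (G : Type u) [Group G] : Type u :=
  TensorSq q G ⧸ Subgroup.normalClosure (Set.range fun g : G => TensorSq.tmul q g g)

namespace ExtSq

/-- The element `g ∧ h`. -/
def wedge (q : ℕ) {G : Type u} [Group G] (g h : G) : ExtSq q G :=
  QuotientGroup.mk' _ (TensorSq.tmul q g h)

/-- The element `k̂`. -/
def hat {q : ℕ} {G : Type u} [Group G] (hq : 1 ≤ q) (k : G) : ExtSq q G :=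
  QuotientGroup.mk' _ (TensorSq.hat hq k)

end ExtSq

/-! ### The action of `G` on the `q`-exterior square -/

theorem conj_mul' {G : Type u} [Group G] (a b x : G) : conj (a * b) x = conj a x * conj b x := by
  simp only [conj]; group

theorem conj_inv' {G : Type u} [Group G] (a x : G) : conj a⁻¹ x = (conj a x)⁻¹ := by
  simp only [conj]; group

theorem conj_pow' {G : Type u} [Group G] (a x : G) (m : ℕ) : conj (a ^ m) x = conj a x ^ m := by
  induction m with
  | zero => simp [conj]
  | succ m ih => rw [pow_succ, conj_mul', ih, pow_succ]

theorem conj_conj' {G : Type u} [Group G] (a b x : G) :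
    conj (conj a b) x = conj (conj a x) (conj b x) := by
  simp only [conj]; group

theorem conj_comm' {G : Type u} [Group G] (a b x : G) :
    conj (comm a b) x = comm (conj a x) (conj b x) := by
  simp only [conj, comm]; group

/-- The effect of `x` on the generators: `g ⊗ h ↦ g^x ⊗ h^x` and `k̂ ↦ (k^x)^`. -/
def genAct (q : ℕ) {G : Type u} [Group G] (x : G) : TensorGen q G → TensorGen q G
  | Sum.inl (g, h) => Sum.inl (conj g x, conj h x)
  | Sum.inr k => Sum.inr ⟨k.pos, conj k.elt x⟩

theorem map_genAct_symT (q : ℕ) {G : Type u} [Group G] (x g h : G) :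
    FreeGroup.map (genAct q x) (symT q g h) = symT q (conj g x) (conj h x) := by
  simp [symT, genAct]

theorem map_genAct_symH {q : ℕ} {G : Type u} [Group G] (hq : 1 ≤ q) (x k : G) :
    FreeGroup.map (genAct q x) (symH hq k) = symH hq (conj k x) := by
  simp [symH, genAct]

theorem map_genAct_rel (q : ℕ) {G : Type u} [Group G] (x : G) {r : FreeGroup (TensorGen q G)}
    (hr : TensorRel q G r) : TensorRel q G (FreeGroup.map (genAct q x) r) := by
  cases hr with
  | mul_right g h h₁ =>
    have := TensorRel.mul_right (q := q) (conj g x) (conj h x) (conj h₁ x)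
    simpa only [map_mul, map_inv, map_genAct_symT, conj_mul', conj_conj' _ _ x] using this
  | mul_left g g₁ h =>
    have := TensorRel.mul_left (q := q) (conj g x) (conj g₁ x) (conj h x)
    simpa only [map_mul, map_inv, map_genAct_symT, conj_mul', conj_conj' _ _ x] using this
  | conj_hat hq g h k =>
    have := TensorRel.conj_hat hq (conj g x) (conj h x) (conj k x)
    rw [conj] at this ⊢
    simpa only [map_mul, map_inv, map_genAct_symT, map_genAct_symH, conj_conj' _ _ x,
      conj_pow'] using this
  | hat_mul hq k k₁ =>
    have := TensorRel.hat_mul hq (conj k x) (conj k₁ x)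
    simpa only [map_mul, map_inv, map_list_prod, List.map_map, Function.comp_def,
      map_genAct_symT, map_genAct_symH, conj_mul', conj_conj' _ _ x, conj_pow', conj_inv']
      using this
  | hat_comm hq k k₁ =>
    have := TensorRel.hat_comm hq (conj k x) (conj k₁ x)
    rw [comm] at this ⊢
    simpa only [map_mul, map_inv, map_genAct_symT, map_genAct_symH, conj_pow'] using this
  | comm_hat hq g h =>
    have := TensorRel.comm_hat hq (conj g x) (conj h x)
    simpa only [map_mul, map_inv, map_pow, map_genAct_symT, map_genAct_symH, conj_comm']
      using this

/-- The action of `x` on `G ⊗^q G`. -/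
def TensorSq.act (q : ℕ) {G : Type u} [Group G] (x : G) : TensorSq q G →* TensorSq q G :=
  PresentedGroup.toGroup (f := fun a => PresentedGroup.of (genAct q x a)) (by
    intro r hr
    have h1 : FreeGroup.lift
          (fun a => (PresentedGroup.of (genAct q x a) : TensorSq q G)) =
        (PresentedGroup.mk {x | TensorRel q G x}).comp (FreeGroup.map (genAct q x)) := by
      ext a; simp [PresentedGroup.of]
    rw [h1]
    exact PresentedGroup.one_of_mem (map_genAct_rel q x hr))

theorem TensorSq.act_tmul (q : ℕ) {G : Type u} [Group G] (x g h : G) :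
    TensorSq.act q x (TensorSq.tmul q g h) = TensorSq.tmul q (conj g x) (conj h x) :=
  PresentedGroup.toGroup.of _

theorem TensorSq.act_hat {q : ℕ} {G : Type u} [Group G] (hq : 1 ≤ q) (x k : G) :
    TensorSq.act q x (TensorSq.hat hq k) = TensorSq.hat hq (conj k x) :=
  PresentedGroup.toGroup.of _

/-- The action of `x` on `G ∧^q G`, written `w ↦ w^x`. -/
def ExtSq.act (q : ℕ) {G : Type u} [Group G] (x : G) : ExtSq q G →* ExtSq q G :=
  QuotientGroup.map _ _ (TensorSq.act q x) (by
    refine Subgroup.normalClosure_le_normal ?_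
    rintro _ ⟨g, rfl⟩
    exact Subgroup.subset_normalClosure ⟨conj g x, (TensorSq.act_tmul q x g g).symm⟩)

theorem ExtSq.act_wedge (q : ℕ) {G : Type u} [Group G] (x g h : G) :
    ExtSq.act q x (ExtSq.wedge q g h) = ExtSq.wedge q (conj g x) (conj h x) :=
  congrArg (QuotientGroup.mk' _) (TensorSq.act_tmul q x g h)

theorem ExtSq.act_hat {q : ℕ} {G : Type u} [Group G] (hq : 1 ≤ q) (x k : G) :
    ExtSq.act q x (ExtSq.hat hq k) = ExtSq.hat hq (conj k x) :=
  congrArg (QuotientGroup.mk' _) (TensorSq.act_hat hq x k)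

/-! ### Consistent polycyclic presentations -/

/-- The data of a polycyclic presentation on generators `g_1, ..., g_n`: the index set `I`, the
relative orders `e_i` for `i ∈ I`, and the exponents of the right hand sides. -/
structure PcData (n : ℕ) where
  I : Set (Fin n)
  e : Fin n → ℕ
  e_pos : ∀ i ∈ I, 0 < e i
  α : Fin n → Fin n → ℤ
  β : Fin n → Fin n → Fin n → ℤ
  γ : Fin n → Fin n → Fin n → ℤ

/-- The word `g_{j+1}^{a_{j+1}} ... g_n^{a_n}`. -/
def tailWord {n : ℕ} (j : Fin n) (a : Fin n → ℤ) : FreeGroup (Fin n) :=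
  (((List.finRange n).filter fun k => j < k).map fun k => FreeGroup.of k ^ a k).prod

/-- The relators of a polycyclic presentation. -/
inductive PcData.Rel {n : ℕ} (P : PcData n) : FreeGroup (Fin n) → Prop
  | power (i : Fin n) (hi : i ∈ P.I) : P.Rel
      (FreeGroup.of i ^ P.e i * (tailWord i (P.α i))⁻¹)
  | conj (i j : Fin n) (hji : j < i) : P.Rel
      ((FreeGroup.of j)⁻¹ * FreeGroup.of i * FreeGroup.of j * (tailWord j (P.β i j))⁻¹)
  | conj_inv (i j : Fin n) (hji : j < i) (hj : j ∉ P.I) : P.Rel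
      (FreeGroup.of j * FreeGroup.of i * (FreeGroup.of j)⁻¹ * (tailWord j (P.γ i j))⁻¹)

/-- `⟨g_1, ..., g_n | relators of P⟩` is a presentation of `H` in the elements `g i`, and it is
consistent: each element of `H` is `g_1^{a_1} ... g_n^{a_n}` for exactly one exponent vector `a`
with `0 ≤ a_i < e_i` for all `i ∈ I`. -/
structure IsConsistentPcPresentation {n : ℕ} {H : Type u} [Group H] (P : PcData n)
    (g : Fin n → H) : Prop where
  generates : Function.Surjective (FreeGroup.lift g)
  relations : (FreeGroup.lift g).ker = Subgroup.normalClosure {r | P.Rel r}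
  consistent : ∀ h : H, ∃! a : Fin n → ℤ,
    (∀ i ∈ P.I, 0 ≤ a i ∧ a i < P.e i) ∧ ((List.finRange n).map fun k => g k ^ a k).prod = h

/-! ### The presentation of `τ^q(G)` -/

/-- The generators `g_1, ..., g_n`, `g_1^φ, ..., g_n^φ`, `w_1, ..., w_r`. -/
inductive TauGen (n r : ℕ) : Type
  | g (i : Fin n)
  | gφ (i : Fin n)
  | w (j : Fin r)

open TauGen in
/-- The relators of `τ^q(G)`. Here `P` is the presentation of `G` in the generators `g i`, `U` is that of
`G ∧^q G` in the generators `ω i`, and `word x` is a word in `w_1, ..., w_r` by which the element `x`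
of `G ∧^q G` is expressed. -/
inductive TauRel (q : ℕ) {G : Type u} [Group G] {n r : ℕ} (P : PcData n) (g : Fin n → G)
    (U : PcData r) (ω : Fin r → ExtSq q G) (word : ExtSq q G → FreeGroup (Fin r)) :
    FreeGroup (TauGen n r) → Prop
  | rel_g (x : FreeGroup (Fin n)) (hx : P.Rel x) : TauRel q P g U ω word
      (FreeGroup.map TauGen.g x)
  | rel_gφ (x : FreeGroup (Fin n)) (hx : P.Rel x) : TauRel q P g U ω word
      (FreeGroup.map gφ x)
  | rel_w (u : FreeGroup (Fin r)) (hu : U.Rel u) : TauRel q P g U ω word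
      (FreeGroup.map w u)
  | conj_gφ (i j : Fin n) : TauRel q P g U ω word
      ((FreeGroup.of (TauGen.g i))⁻¹ * FreeGroup.of (gφ j) * FreeGroup.of (TauGen.g i) *
        (FreeGroup.of (gφ j) * (FreeGroup.map w (word (ExtSq.wedge q (g i) (g j))))⁻¹)⁻¹)
  | conj_inv_gφ (i j : Fin n) (hi : i ∉ P.I) : TauRel q P g U ω word
      (FreeGroup.of (TauGen.g i) * FreeGroup.of (gφ j) * (FreeGroup.of (TauGen.g i))⁻¹ *
        (FreeGroup.of (gφ j) * (FreeGroup.map w (word (ExtSq.wedge q (g i)⁻¹ (g j))))⁻¹)⁻¹)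
  | conj_w (i : Fin r) (j : Fin n) : TauRel q P g U ω word
      ((FreeGroup.of (TauGen.g j))⁻¹ * FreeGroup.of (w i) * FreeGroup.of (TauGen.g j) *
        (FreeGroup.map w (word (ExtSq.act q (g j) (ω i))))⁻¹)
  | conj_inv_w (i : Fin r) (j : Fin n) (hj : j ∉ P.I) : TauRel q P g U ω word
      (FreeGroup.of (TauGen.g j) * FreeGroup.of (w i) * (FreeGroup.of (TauGen.g j))⁻¹ *
        (FreeGroup.map w (word (ExtSq.act q (g j)⁻¹ (ω i))))⁻¹)
  | conjφ_w (i : Fin r) (j : Fin n) : TauRel q P g U ω word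
      ((FreeGroup.of (gφ j))⁻¹ * FreeGroup.of (w i) * FreeGroup.of (gφ j) *
        (FreeGroup.map w (word (ExtSq.act q (g j) (ω i))))⁻¹)
  | conjφ_inv_w (i : Fin r) (j : Fin n) (hj : j ∉ P.I) : TauRel q P g U ω word
      (FreeGroup.of (gφ j) * FreeGroup.of (w i) * (FreeGroup.of (gφ j))⁻¹ *
        (FreeGroup.map w (word (ExtSq.act q (g j)⁻¹ (ω i))))⁻¹)

/-- The group `τ^q(G)` presented by the generators `g_i`, `g_i^φ`, `w_j` and the relators
above. -/
abbrev Tau (q : ℕ) {G : Type u} [Group G] {n r : ℕ} (P : PcData n) (g : Fin n → G)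
    (U : PcData r) (ω : Fin r → ExtSq q G) (word : ExtSq q G → FreeGroup (Fin r)) : Type :=
  PresentedGroup {x | TauRel q P g U ω word x}

end QTensor

namespace QTensor

/-! ### Commutator pairings -/

section Group

variable {H : Type*} [Group H]

/-! The obstruction to identifying $G\wedge^qG$ with a subgroup of $\nu^q(G)$ consists of the
diagonal elements $[g,g^\varphi]$: they are trivial in the exterior square, so they must be shown to
vanish in $\nu^q(G)$. This is where $q$-perfectness enters. The relation
$\widehat{[g,g]}=[g,g^\varphi]^q$ bounds their order by $q$, and they commute with $G$ and
$G^\varphi$. For fixed $b$ the symmetrization $a\mapsto[a,b^\varphi][b,a^\varphi]$ is then a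
homomorphism killing commutators and $q$-th powers, hence trivial. It is exactly the defect of
$a\mapsto[a,a^\varphi]$ from being multiplicative, so that map is a homomorphism as well and dies
for the same reason (`IsNuPair.comm_self_eq_one`).

Thus $g\wedge h\mapsto[g,h^\varphi]$, $\widehat k\mapsto\widehat k$ defines a map $\psi$ from
$G\wedge^qG$ to $\nu^q(G)$, which yields $\tau^q(G)\to\nu^q(G)$ on generators. For the inverse, the
relators of $\tau^q(G)$ give the action and the wedge–commutator identity on generators only;
`conj_eq_map_act` and `map_wedge_eq_comm` spread them to all elements, after which every relation of
$\nu^q(G)$ comes from $G\wedge^qG$ or from this action. -/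

theorem conj_one_right (x : H) : conj x 1 = x := by simp [conj]

theorem conj_one_left (x : H) : conj 1 x = 1 := by simp [conj]

theorem conj_mul_right (x a b : H) : conj x (a * b) = conj (conj x a) b := by
  simp only [conj]; group

theorem comm_self (x : H) : comm x x = 1 := by simp [comm]

theorem comm_one_left (x : H) : comm 1 x = 1 := by simp [comm]

theorem comm_one_right (x : H) : comm x 1 = 1 := by simp [comm]

theorem commute_of_conj_eq {x a : H} (h : conj x a = x) : Commute x a := by
  rw [conj, mul_assoc, inv_mul_eq_iff_eq_mul] at h
  exact h

theorem map_conj {K : Type*} [Group K] (f : H →* K) (x a : H) :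
    f (conj x a) = conj (f x) (f a) := by simp [conj]

theorem map_comm {K : Type*} [Group K] (f : H →* K) (x a : H) :
    f (comm x a) = comm (f x) (f a) := by simp [comm]

end Group

/-! ### Commutator calculus under the relations of $\nu(G)$. -/

/-- The homomorphisms `l` and `r` satisfy the defining relations of `ν(G)`. -/
structure IsNuPair {G H : Type*} [Group G] [Group H] (l r : G →* H) : Prop where
  conj_left (g h k : G) : conj (comm (l g) (r h)) (l k) = comm (l (conj g k)) (r (conj h k))
  conj_right (g h k : G) : conj (comm (l g) (r h)) (r k) = comm (l (conj g k)) (r (conj h k))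

theorem comm_map_mul_right {G H : Type*} [Group G] [Group H] (l r : G →* H) (g h k : G) :
    comm (l g) (r (h * k)) = comm (l g) (r k) * conj (comm (l g) (r h)) (r k) := by
  simp only [comm, conj, map_mul]; group

theorem comm_map_mul_left {G H : Type*} [Group G] [Group H] (l r : G →* H) (g h k : G) :
    comm (l (g * h)) (r k) = conj (comm (l g) (r k)) (l h) * comm (l h) (r k) := by
  simp only [comm, conj, map_mul]; group

namespace IsNuPair

variable {G H : Type*} [Group G] [Group H] {l r : G →* H}

/-- The element $[a,b^\varphi]$ is a word in $a$ and $b^\varphi$, and each letter acts on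
commutators as the corresponding element of $G$; hence the whole word acts as $[a,b]$. -/
theorem conj_comm (hp : IsNuPair l r) (g h a b : G) :
    conj (comm (l g) (r h)) (comm (l a) (r b)) =
      comm (l (conj g (comm a b))) (r (conj h (comm a b))) := by
  rw [comm.eq_1 (l a) (r b), comm.eq_1 a b]
  simp only [← map_inv, conj_mul_right, hp.conj_left, hp.conj_right]

/-- This says that $[[g,h],k^\varphi]=[[g,h^\varphi],k^\varphi]$. The left side is expanded along
$[g,h]=g^{-1}g^h$. -/
theorem comm_comm_left (hp : IsNuPair l r) (g h k : G) :
    comm (l (comm g h)) (r k) = (comm (l g) (r h))⁻¹ * conj (comm (l g) (r h)) (r k) := by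
  have h1 : comm g h = g⁻¹ * conj g h := by simp only [comm, conj]; group
  have h2 : conj (comm (l g⁻¹) (r k)) (l (conj g h)) =
      (conj (comm (l g) (r k)) (comm (l g) (r h)))⁻¹ := by
    rw [hp.conj_comm, ← hp.conj_left, h1, map_mul, conj_mul_right, ← conj_inv']
    congr 1
    simp only [comm, conj, map_inv]; group
  -- Two expansions of $[g,(hk)^\varphi]$, the other one from $hk=k^{h^{-1}}h$.
  have h3 : comm (l g) (r h) * comm (l (conj g h)) (r k) =
      comm (l g) (r k) * conj (comm (l g) (r h)) (r k) := by
    have e : conj (conj k h⁻¹) h = k := by simp only [conj]; group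
    rw [← comm_map_mul_right, ← e, ← hp.conj_right, ← comm_map_mul_right, e]
    congr 2
    simp only [conj]; group
  nth_rw 1 [h1]
  rw [comm_map_mul_left, h2, conj, eq_inv_mul_iff_mul_eq, ← mul_right_inj (comm (l g) (r k)), ← h3]
  group

/-- Mirror image of `comm_comm_left`: $[k,[g,h]^\varphi]=[k,[g,h^\varphi]]$. -/
theorem comm_comm_right (hp : IsNuPair l r) (g h k : G) :
    comm (l k) (r (comm g h)) = (conj (comm (l g) (r h)) (l k))⁻¹ * comm (l g) (r h) := by
  have h1 : comm g h = (conj h g)⁻¹ * h := by simp only [comm, conj]; group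
  have h2 : conj (comm (l k) (r (conj h g)⁻¹)) (r h) =
      (conj (comm (l k) (r (conj h g))) (comm (l g) (r h)))⁻¹ := by
    rw [hp.conj_comm, ← hp.conj_right, h1]
    generalize conj h g = x
    rw [map_mul, conj_mul_right, ← conj_inv']
    congr 1
    simp only [comm, conj, map_inv]; group
  have h3 : comm (l k) (r (conj h g)) * comm (l g) (r h) =
      conj (comm (l g) (r h)) (l k) * comm (l k) (r h) := by
    have e : conj (conj k g⁻¹) g = k := by simp only [conj]; group
    rw [← comm_map_mul_left, ← e, ← hp.conj_left, ← comm_map_mul_left, e]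
    congr 2
    simp only [conj]; group
  nth_rw 1 [h1]
  rw [comm_map_mul_right, h2, conj, eq_inv_mul_iff_mul_eq]
  rw [← mul_assoc, ← h3]
  group

/-! ### Diagonal elements $[g,g^\varphi]$ and the symmetrization $[g,h^\varphi][h,g^\varphi]$. -/

/-- Since $[g,g]=1$, `comm_comm_left` with $h=g$ shows that $k^\varphi$ fixes $[g,g^\varphi]$. -/
theorem conj_comm_self (hp : IsNuPair l r) (g k : G) :
    comm (l (conj g k)) (r (conj g k)) = comm (l g) (r g) := by
  have h := hp.comm_comm_left g g k
  rw [comm_self, map_one, comm_one_left, hp.conj_right, eq_comm, inv_mul_eq_one] at h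
  exact h.symm

theorem commute_comm_self_left (hp : IsNuPair l r) (g k : G) :
    Commute (comm (l g) (r g)) (l k) :=
  commute_of_conj_eq (by rw [hp.conj_left, hp.conj_comm_self])

theorem commute_comm_self_right (hp : IsNuPair l r) (g k : G) :
    Commute (comm (l g) (r g)) (r k) :=
  commute_of_conj_eq (by rw [hp.conj_right, hp.conj_comm_self])

theorem commute_comm_self_comm (hp : IsNuPair l r) (g a b : G) :
    Commute (comm (l g) (r g)) (comm (l a) (r b)) := by
  have ha := hp.commute_comm_self_left g a
  have hb := hp.commute_comm_self_right g b
  exact ((ha.inv_right.mul_right hb.inv_right).mul_right ha).mul_right hb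

/-- Bilinear expansion yields two diagonal and two mixed terms; the diagonal ones commute with
everything in sight and are moved to the front. -/
theorem comm_self_mul (hp : IsNuPair l r) (g h : G) :
    comm (l (g * h)) (r (g * h)) = comm (l g) (r g) * comm (l h) (r h) *
      conj (comm (l g) (r h) * comm (l h) (r g)) (r h) := by
  have c1 := hp.commute_comm_self_comm h (conj g h) (conj h h)
  have c2 := hp.commute_comm_self_comm g (conj g h) (conj h h)
  rw [comm_map_mul_right, comm_map_mul_left, comm_map_mul_left, conj_mul', conj_mul',
    hp.conj_left, hp.conj_left, hp.conj_comm_self, hp.conj_right, hp.conj_right, hp.conj_right,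
    hp.conj_comm_self, ← c1.eq, ← mul_assoc, ← mul_assoc]
  congr 1
  rw [mul_assoc, ← c2.eq, ← mul_assoc, (hp.commute_comm_self_comm g h h).eq]

/-- Let $s$ be the symmetrization. By `comm_self_mul`, $s^{h^\varphi}$ is a product of diagonal
elements and their inverses, so $G$ fixes it. As $k$ and $k^\varphi$ act alike on $s$, this gives
$s^k=s^h$ for every $k$, and $k=1$ gives $s^h=s$. -/
theorem symmetrization_conj (hp : IsNuPair l r) (g h k : G) :
    conj (comm (l g) (r h) * comm (l h) (r g)) (l k) = comm (l g) (r h) * comm (l h) (r g) := by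
  have key (g h : G) : conj (comm (l g) (r h) * comm (l h) (r g)) (r h) =
      (comm (l g) (r g) * comm (l h) (r h))⁻¹ * comm (l (g * h)) (r (g * h)) := by
    rw [hp.comm_self_mul, inv_mul_cancel_left]
  have h1 (g h k : G) : conj (conj (comm (l g) (r h) * comm (l h) (r g)) (r h)) (l k) =
      conj (comm (l g) (r h) * comm (l h) (r g)) (r h) := by
    rw [key, conj_mul', conj_inv', conj_mul']
    simp only [hp.conj_left, hp.conj_comm_self]
  have h3 (k : G) : conj (comm (l g) (r h) * comm (l h) (r g)) (l k) =
      conj (comm (l g) (r h) * comm (l h) (r g)) (r k) := by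
    simp only [conj_mul', hp.conj_left, hp.conj_right]
  have h4 (k : G) : conj (comm (l g) (r h) * comm (l h) (r g)) (l k) =
      conj (comm (l g) (r h) * comm (l h) (r g)) (l h) := by
    have := h1 g h (h⁻¹ * k)
    rwa [← h3, ← conj_mul_right, ← map_mul, mul_inv_cancel_left] at this
  rw [h4, ← h4 1, map_one, conj_one_right]

/-- In the expansion the symmetrization of $g_1,h$ appears in the middle; by `symmetrization_conj`
it commutes past the last factor, and the outer factors combine to an invariant conjugate. -/
theorem symmetrization_mul (hp : IsNuPair l r) (g g₁ h : G) :
    comm (l (g * g₁)) (r h) * comm (l h) (r (g * g₁)) =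
      comm (l g) (r h) * comm (l h) (r g) * (comm (l g₁) (r h) * comm (l h) (r g₁)) := by
  have h1 := hp.symmetrization_conj g h g₁
  have h2 : Commute (comm (l g₁) (r h) * comm (l h) (r g₁)) (conj (comm (l h) (r g)) (l g₁)) := by
    rw [hp.conj_left]
    have hl k : Commute (comm (l g₁) (r h) * comm (l h) (r g₁)) (l k) :=
      commute_of_conj_eq (hp.symmetrization_conj g₁ h k)
    have hr k : Commute (comm (l g₁) (r h) * comm (l h) (r g₁)) (r k) :=
      commute_of_conj_eq (by
        have := hp.symmetrization_conj g₁ h k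
        simpa only [conj_mul', hp.conj_left, hp.conj_right] using this)
    exact (((hl _).inv_right.mul_right (hr _).inv_right).mul_right (hl _)).mul_right (hr _)
  have h3 : conj (comm (l h) (r g)) (r g₁) = conj (comm (l h) (r g)) (l g₁) := by
    rw [hp.conj_left, hp.conj_right]
  rw [comm_map_mul_left, comm_map_mul_right, h3, mul_assoc, ← mul_assoc (comm (l g₁) (r h)), h2.eq,
    ← mul_assoc, ← conj_mul', h1]

/-- If `G` is `q`-perfect and every `[g, g^φ]` has order dividing `q`, then `[g, g^φ] = 1`. -/
theorem comm_self_eq_one (hp : IsNuPair l r) {q : ℕ} (hG : IsQPerfect q G)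
    (hq : ∀ g, comm (l g) (r g) ^ q = 1) (g : G) : comm (l g) (r g) = 1 := by
  have induct {S : Subgroup G} (hc : ∀ a b, comm a b ∈ S) (hpow : ∀ a, a ^ q ∈ S) : S = ⊤ := by
    rw [eq_top_iff, ← hG, sup_le_iff, commutator_def, Subgroup.commutator_le,
      Subgroup.closure_le]
    refine ⟨fun a _ b _ => ?_, ?_⟩
    -- The inverses pass from $[a,b]=a^{-1}b^{-1}ab$ to the convention $aba^{-1}b^{-1}$ of
    -- `commutatorElement_def`.
    · have := hc a⁻¹ b⁻¹
      simpa [comm, commutatorElement_def] using this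
    · rintro _ ⟨a, rfl⟩
      exact hpow a
  have hsym (a b : G) : comm (l a) (r b) * comm (l b) (r a) =
      (comm (l a) (r a) * comm (l b) (r b))⁻¹ * comm (l (a * b)) (r (a * b)) := by
    have := hp.symmetrization_conj a b b
    have h' : conj (comm (l a) (r b) * comm (l b) (r a)) (r b) =
        comm (l a) (r b) * comm (l b) (r a) := by
      simpa only [conj_mul', hp.conj_left, hp.conj_right] using this
    rw [hp.comm_self_mul, inv_mul_cancel_left, h']
  -- By `hsym` the symmetrization is a product of commuting elements of order dividing $q$.
  have hsymq (a b : G) : (comm (l a) (r b) * comm (l b) (r a)) ^ q = 1 := by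
    have c := hp.commute_comm_self_comm
    rw [hsym, Commute.mul_pow ((c _ _ _).symm.mul_right (c _ _ _).symm).symm.inv_left, inv_pow,
      (c a b b).mul_pow, hq, hq, hq]
    simp
  let f (b : G) : G →* H :=
    { toFun a := comm (l a) (r b) * comm (l b) (r a)
      map_one' := by simp [comm]
      map_mul' a a₁ := hp.symmetrization_mul a a₁ b }
  have hf (a b : G) : comm (l a) (r b) * comm (l b) (r a) = 1 := by
    have : (f b).ker = ⊤ := induct (fun x y => by
        change comm (l (comm x y)) (r b) * comm (l b) (r (comm x y)) = 1
        -- With $t=[x,y^\varphi]$ the two factors are $t^{-1}t^b$ and $(t^b)^{-1}t$, which cancel.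
        rw [hp.comm_comm_left, hp.comm_comm_right, hp.conj_left, hp.conj_right]
        group) (fun x => by
        rw [MonoidHom.mem_ker, map_pow]
        exact hsymq x b)
    exact MonoidHom.mem_ker.1 (this ▸ Subgroup.mem_top a)
  let d : G →* H :=
    { toFun a := comm (l a) (r a)
      map_one' := by simp [comm]
      map_mul' a b := by rw [hp.comm_self_mul, hf, conj_one_left, mul_one] }
  -- Diagonal elements commute with each other, so `d` kills commutators.
  have hd : d.ker = ⊤ := induct (fun x y => by
      have : Commute (d x)⁻¹ (d y)⁻¹ := (hp.commute_comm_self_comm x y y).inv_inv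
      rw [MonoidHom.mem_ker, map_comm, comm, this.eq]
      group) (fun x => by
      rw [MonoidHom.mem_ker, map_pow]
      exact hq x)
  exact MonoidHom.mem_ker.1 (hd ▸ Subgroup.mem_top g)

end IsNuPair

/-! ### Presentations -/

/-- Von Dyck's theorem for a group whose presentation is given as a kernel rather than as a
`PresentedGroup`. -/
theorem exists_hom_of_presentation {n : ℕ} {G : Type*} [Group G] {g : Fin n → G}
    {R : Set (FreeGroup (Fin n))} (hsurj : Function.Surjective (FreeGroup.lift g))
    (hker : (FreeGroup.lift g).ker = Subgroup.normalClosure R) {K : Type*} [Group K]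
    (f : FreeGroup (Fin n) →* K) (hf : ∀ x ∈ R, f x = 1) :
    ∃ φ : G →* K, ∀ v, φ (FreeGroup.lift g v) = f v := by
  have hle : (FreeGroup.lift g).ker ≤ f.ker := by
    rw [hker]
    exact Subgroup.normalClosure_le_normal hf
  exact ⟨(FreeGroup.lift g).liftOfSurjective hsurj ⟨f, hle⟩, fun v =>
    MonoidHom.liftOfRightInverse_comp_apply _ _ _ ⟨f, hle⟩ v⟩

theorem subgroup_eq_top_of_generators {n : ℕ} {G : Type*} [Group G] {g : Fin n → G}
    (hsurj : Function.Surjective (FreeGroup.lift g)) {S : Subgroup G} (hS : ∀ i, g i ∈ S) :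
    S = ⊤ := by
  rw [eq_top_iff, ← MonoidHom.range_eq_top.2 hsurj, FreeGroup.range_lift_eq_closure,
    Subgroup.closure_le]
  rintro _ ⟨i, rfl⟩
  exact hS i

theorem hom_eq_of_generators {n : ℕ} {G : Type*} [Group G] {g : Fin n → G}
    (hsurj : Function.Surjective (FreeGroup.lift g)) {K : Type*} [Group K] {f₁ f₂ : G →* K}
    (h : ∀ i, f₁ (g i) = f₂ (g i)) : f₁ = f₂ := by
  refine (MonoidHom.cancel_right hsurj).1 ?_
  ext i
  simpa using h i

/-! ### Relations in the `q`-tensor square and the `q`-exterior square -/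

theorem TensorSq.mk_eq_one {q : ℕ} {G : Type*} [Group G] {x : FreeGroup (TensorGen q G)}
    (hx : TensorRel q G x) : PresentedGroup.mk {x | TensorRel q G x} x = 1 :=
  PresentedGroup.one_of_mem hx

namespace ExtSq

variable {q : ℕ} {G : Type*} [Group G]

theorem wedge_mul_right (g h h₁ : G) :
    wedge q g (h * h₁) = wedge q g h₁ * wedge q (conj g h₁) (conj h h₁) := by
  have h := TensorSq.mk_eq_one (TensorRel.mul_right (q := q) g h h₁)
  rw [map_mul, map_inv, mul_inv_eq_one, map_mul] at h
  exact congrArg (QuotientGroup.mk' _) h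

theorem wedge_mul_left (g g₁ h : G) :
    wedge q (g * g₁) h = wedge q (conj g g₁) (conj h g₁) * wedge q g₁ h := by
  have h := TensorSq.mk_eq_one (TensorRel.mul_left (q := q) g g₁ h)
  rw [map_mul, map_inv, mul_inv_eq_one, map_mul] at h
  exact congrArg (QuotientGroup.mk' _) h

theorem conj_wedge_hat (hq : 1 ≤ q) (g h k : G) :
    conj (wedge q g h) (hat hq k) = wedge q (conj g (k ^ q)) (conj h (k ^ q)) := by
  have h := TensorSq.mk_eq_one (TensorRel.conj_hat hq g h k)
  rw [map_mul, map_inv, mul_inv_eq_one, map_conj] at h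
  exact (map_conj (QuotientGroup.mk' _) _ _).symm.trans (congrArg (QuotientGroup.mk' _) h)

theorem hat_mul (hq : 1 ≤ q) (k k₁ : G) :
    hat hq (k * k₁) = hat hq k * ((List.range' 1 (q - 1)).map fun i =>
      wedge q (conj k (k ^ (q - 1 - i))) (conj (k₁⁻¹ ^ i) (k ^ (q - 1 - i)))).prod *
      hat hq k₁ := by
  have h := TensorSq.mk_eq_one (TensorRel.hat_mul hq k k₁)
  rw [map_mul, map_inv, mul_inv_eq_one] at h
  have h' := congrArg (QuotientGroup.mk' (Subgroup.normalClosure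
    (Set.range fun g : G => TensorSq.tmul q g g))) h
  simp only [map_mul, map_list_prod, List.map_map] at h'
  exact h'

theorem comm_hat_hat (hq : 1 ≤ q) (k k₁ : G) :
    comm (hat hq k) (hat hq k₁) = wedge q (k ^ q) (k₁ ^ q) := by
  have h := TensorSq.mk_eq_one (TensorRel.hat_comm hq k k₁)
  rw [map_mul, map_inv, mul_inv_eq_one, map_comm] at h
  exact (map_comm (QuotientGroup.mk' _) _ _).symm.trans (congrArg (QuotientGroup.mk' _) h)

theorem hat_comm (hq : 1 ≤ q) (g h : G) : hat hq (comm g h) = wedge q g h ^ q := by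
  have h := TensorSq.mk_eq_one (TensorRel.comm_hat hq g h)
  rw [map_mul, map_inv, mul_inv_eq_one, map_pow] at h
  exact congrArg (QuotientGroup.mk' _) h

theorem hom_ext {K : Type*} [Group K] {f₁ f₂ : ExtSq q G →* K}
    (hw : ∀ g h, f₁ (wedge q g h) = f₂ (wedge q g h))
    (hh : ∀ (hq : 1 ≤ q) k, f₁ (hat hq k) = f₂ (hat hq k)) : f₁ = f₂ := by
  apply QuotientGroup.monoidHom_ext
  apply PresentedGroup.ext
  rintro (⟨g, h⟩ | ⟨hq, k⟩)
  · exact hw g h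
  · exact hh hq k

/-- `act q x` is defined for each `x` separately; this lemma and `act_act` make it a right action.
-/
theorem act_one (x : ExtSq q G) : act q 1 x = x := by
  have : act q (1 : G) = MonoidHom.id _ := hom_ext
    (fun g h => by simp [act_wedge, conj_one_right]) (fun hq k => by simp [act_hat, conj_one_right])
  rw [this, MonoidHom.id_apply]

theorem act_act (a b : G) (x : ExtSq q G) : act q b (act q a x) = act q (a * b) x := by
  have : (act q b).comp (act q a) = act q (a * b) := hom_ext
    (fun g h => by simp [act_wedge, conj_mul_right]) (fun hq k => by simp [act_hat, conj_mul_right])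
  exact DFunLike.congr_fun this x

end ExtSq

/-! ### The natural maps into `ν^q(G)` -/

namespace NuQ

variable {q : ℕ} {G : Type*} [Group G]

theorem mk_eq_one {x : NuHat q G} (hx : NuQRel q G x) :
    QuotientGroup.mk' (Subgroup.normalClosure {x | NuQRel q G x}) x = 1 :=
  (QuotientGroup.eq_one_iff x).2 (Subgroup.subset_normalClosure hx)

theorem isNuPair (q : ℕ) (G : Type*) [Group G] : IsNuPair (left q (G := G)) (right q) := by
  have key {x : Monoid.Coprod G G} (hx : NuRel G x) :
      QuotientGroup.mk' (Subgroup.normalClosure {x | NuRel G x}) x = 1 :=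
    (QuotientGroup.eq_one_iff x).2 (Subgroup.subset_normalClosure hx)
  let p : Nu G →* NuQ q G := (QuotientGroup.mk' _).comp Monoid.Coprod.inl
  constructor <;> intro g h k
  · have := key (NuRel.left g h k)
    rw [map_mul, map_inv, mul_inv_eq_one] at this
    have h' := congrArg p this
    simp only [map_conj, map_comm] at h' ⊢
    exact h'
  · have := key (NuRel.right g h k)
    rw [map_mul, map_inv, mul_inv_eq_one] at this
    have h' := congrArg p this
    simp only [map_conj, map_comm] at h' ⊢
    exact h'

theorem conj_hat_left (hq : 1 ≤ q) (g k : G) :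
    conj (hat hq k) (left q g) = hat hq (conj k g) := by
  have h := mk_eq_one (NuQRel.conj_left hq g k)
  rw [map_mul, map_inv, mul_inv_eq_one] at h
  simp only [map_mul, map_inv] at h
  exact h

theorem conj_hat_right (hq : 1 ≤ q) (g k : G) :
    conj (hat hq k) (right q g) = hat hq (conj k g) := by
  have h := mk_eq_one (NuQRel.conj_right hq g k)
  rw [map_mul, map_inv, mul_inv_eq_one] at h
  simp only [map_mul, map_inv] at h
  exact h

theorem conj_comm_hat (hq : 1 ≤ q) (g h k : G) :
    conj (comm (left q g) (right q h)) (hat hq k) =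
      comm (left q (conj g (k ^ q))) (right q (conj h (k ^ q))) := by
  have h := mk_eq_one (NuQRel.conj_hat hq g h k)
  rw [map_mul, map_inv, mul_inv_eq_one] at h
  simp only [map_mul, map_inv, map_comm] at h
  exact h

theorem hat_mul (hq : 1 ≤ q) (k k₁ : G) :
    hat hq (k * k₁) = hat hq k * ((List.range' 1 (q - 1)).map fun i =>
      conj (comm (left q k) (right q (k₁⁻¹ ^ i))) (left q (k ^ (q - 1 - i)))).prod *
      hat hq k₁ := by
  have h := mk_eq_one (NuQRel.hat_mul hq k k₁)
  rw [map_mul, map_inv, mul_inv_eq_one] at h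
  simp only [map_mul, map_inv, map_list_prod, List.map_map] at h
  rw [mul_inv_eq_iff_eq_mul, inv_mul_eq_iff_eq_mul, ← mul_assoc] at h
  exact h

theorem comm_hat_hat (hq : 1 ≤ q) (k k₁ : G) :
    comm (hat hq k) (hat hq k₁) = comm (left q (k ^ q)) (right q (k₁ ^ q)) := by
  have h := mk_eq_one (NuQRel.hat_comm hq k k₁)
  rw [map_mul, map_inv, mul_inv_eq_one] at h
  simp only [map_comm] at h
  exact h

theorem hat_comm (hq : 1 ≤ q) (g h : G) :
    hat hq (comm g h) = comm (left q g) (right q h) ^ q := by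
  have h := mk_eq_one (NuQRel.comm_hat hq g h)
  rw [map_mul, map_inv, mul_inv_eq_one] at h
  simp only [map_comm, map_pow] at h
  exact h

theorem hom_ext {K : Type*} [Group K] {f₁ f₂ : NuQ q G →* K}
    (hl : f₁.comp (left q) = f₂.comp (left q)) (hr : f₁.comp (right q) = f₂.comp (right q))
    (hh : ∀ (hq : 1 ≤ q) k, f₁ (hat hq k) = f₂ (hat hq k)) : f₁ = f₂ := by
  apply QuotientGroup.monoidHom_ext
  apply Monoid.Coprod.hom_ext
  · apply QuotientGroup.monoidHom_ext
    exact Monoid.Coprod.hom_ext hl hr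
  · apply FreeGroup.ext_hom
    rintro ⟨hq, k⟩
    exact hh hq k

/-! ### Vanishing of $[g,g^\varphi]$, and maps out of $G\wedge^qG$ and $\nu^q(G)$. -/

theorem hat_one (hq : 1 ≤ q) : hat hq (1 : G) = 1 := by
  have h := hat_mul hq (1 : G) 1
  have e : ((List.range' 1 (q - 1)).map fun i => conj (comm (left q (1 : G))
      (right q ((1 : G)⁻¹ ^ i))) (left q ((1 : G) ^ (q - 1 - i)))).prod = 1 := by
    simp [comm, conj]
  rwa [e, mul_one, mul_one, left_eq_mul] at h

/-- For $q\ge1$, $[g,g^\varphi]^q=\widehat{[g,g]}=\widehat1=1$; for $q=0$ the condition on orders is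
empty. -/
theorem comm_self_eq_one (hG : IsQPerfect q G) (g : G) : comm (left q g) (right q g) = 1 := by
  refine (isNuPair q G).comm_self_eq_one hG (fun a => ?_) g
  rcases Nat.eq_zero_or_pos q with rfl | hq
  · exact pow_zero _
  · rw [← hat_comm hq, comm_self, hat_one]

/-- For a `q`-perfect group `G`, `g ∧ h ↦ [g, h^φ]` and `k̂ ↦ k̂` define a homomorphism
`G ∧^q G → ν^q(G)`. -/
theorem exists_hom_of_extSq (hG : IsQPerfect q G) : ∃ ψ : ExtSq q G →* NuQ q G,
    (∀ g h, ψ (ExtSq.wedge q g h) = comm (left q g) (right q h)) ∧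
    ∀ (hq : 1 ≤ q) k, ψ (ExtSq.hat hq k) = hat hq k := by
  have hp := isNuPair q G
  let f : TensorGen q G → NuQ q G :=
    Sum.elim (fun p => comm (left q p.1) (right q p.2)) (fun k => hat k.pos k.elt)
  have hT (g h : G) : FreeGroup.lift f (symT q g h) = comm (left q g) (right q h) :=
    FreeGroup.lift_apply_of
  have hH (hq : 1 ≤ q) (k : G) : FreeGroup.lift f (symH hq k) = hat hq k :=
    FreeGroup.lift_apply_of
  have hrel : ∀ x ∈ {x | TensorRel q G x}, FreeGroup.lift f x = 1 := by
    rintro x (⟨g, h, h₁⟩ | ⟨g, g₁, h⟩ | ⟨hq, g, h, k⟩ | ⟨hq, k, k₁⟩ | ⟨hq, k, k₁⟩ | ⟨hq, g, h⟩)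
    · rw [map_mul, map_inv, mul_inv_eq_one, map_mul, hT, hT, hT, comm_map_mul_right,
        hp.conj_right]
    · rw [map_mul, map_inv, mul_inv_eq_one, map_mul, hT, hT, hT, comm_map_mul_left,
        hp.conj_left]
    · rw [map_mul, map_inv, mul_inv_eq_one, map_conj, hT, hT, hH, conj_comm_hat]
    · rw [map_mul, map_inv, mul_inv_eq_one, map_mul, map_mul, hH, hH, hH, hat_mul, map_list_prod,
        List.map_map]
      simp only [Function.comp_def, hT, hp.conj_left]
    · rw [map_mul, map_inv, mul_inv_eq_one, map_comm, hT, hH, hH, comm_hat_hat]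
    · rw [map_mul, map_inv, mul_inv_eq_one, map_pow, hT, hH, hat_comm]
  let ψ₀ : TensorSq q G →* NuQ q G := PresentedGroup.toGroup hrel
  refine ⟨QuotientGroup.lift _ ψ₀ (Subgroup.normalClosure_le_normal ?_), hT, hH⟩
  rintro _ ⟨g, rfl⟩
  -- The only relators that do not already hold by the definition of $\nu^q(G)$; $q$-perfectness is
  -- needed exactly here.
  exact (hT g g).trans (comm_self_eq_one hG g)

/-- A homomorphism defined on `G ∧^q G` and compatible with two homomorphisms defined on `G`
extends to `ν^q(G)`. -/
theorem exists_hom_of_compatible {K : Type*} [Group K] (l r : G →* K) (μ : ExtSq q G →* K)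
    (hw : ∀ g h, μ (ExtSq.wedge q g h) = comm (l g) (r h))
    (hl : ∀ x k, conj (μ x) (l k) = μ (ExtSq.act q k x))
    (hr : ∀ x k, conj (μ x) (r k) = μ (ExtSq.act q k x)) :
    ∃ Ψ : NuQ q G →* K, (∀ g, Ψ (left q g) = l g) ∧ (∀ g, Ψ (right q g) = r g) ∧
      ∀ (hq : 1 ≤ q) k, Ψ (hat hq k) = μ (ExtSq.hat hq k) := by
  let ν : Nu G →* K := QuotientGroup.lift _ (Monoid.Coprod.lift l r) (by
    refine Subgroup.normalClosure_le_normal ?_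
    rintro x (⟨g, h, k⟩ | ⟨g, h, k⟩) <;> change Monoid.Coprod.lift l r _ = 1
    · simp only [map_mul, map_inv, mul_inv_eq_one, map_conj, map_comm, Monoid.Coprod.lift_apply_inl,
        Monoid.Coprod.lift_apply_inr, ← hw, hl, ExtSq.act_wedge]
      simp only [hw, map_conj]
    · simp only [map_mul, map_inv, mul_inv_eq_one, map_conj, map_comm, Monoid.Coprod.lift_apply_inl,
        Monoid.Coprod.lift_apply_inr, ← hw, hr, ExtSq.act_wedge]
      simp only [hw, map_conj])
  let Ψ₀ : NuHat q G →* K :=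
    Monoid.Coprod.lift ν (FreeGroup.lift fun k : Hat q G => μ (ExtSq.hat k.pos k.elt))
  have h1 (g : G) : Ψ₀ (NuHat.left q g) = l g := rfl
  have h2 (g : G) : Ψ₀ (NuHat.right q g) = r g := rfl
  have h3 (hq : 1 ≤ q) (k : G) : Ψ₀ (NuHat.hat hq k) = μ (ExtSq.hat hq k) :=
    (Monoid.Coprod.lift_apply_inr _ _ _).trans FreeGroup.lift_apply_of
  refine ⟨QuotientGroup.lift _ Ψ₀ (Subgroup.normalClosure_le_normal ?_), h1, h2, h3⟩
  -- The first two families are the compatibility of `μ` with the action; the others are images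
  -- under `μ` of relations in $G\wedge^qG$.
  rintro x (⟨hq, g, k⟩ | ⟨hq, g, k⟩ | ⟨hq, g, h, k⟩ | ⟨hq, k, k₁⟩ | ⟨hq, k, k₁⟩ | ⟨hq, g, h⟩) <;>
    change Ψ₀ _ = 1 <;> rw [map_mul, map_inv, mul_inv_eq_one]
  · rw [← conj.eq_1, map_conj, h1, h3, h3, hl, ExtSq.act_hat]
  · rw [← conj.eq_1, map_conj, h2, h3, h3, hr, ExtSq.act_hat]
  · rw [← conj.eq_1, map_conj, map_comm, map_comm, h1, h1, h2, h2, h3, ← hw, ← hw, ← map_conj,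
      ExtSq.conj_wedge_hat]
  · rw [map_mul, map_mul, map_inv, map_inv, h3, h3, h3, ExtSq.hat_mul, map_mul, map_mul,
      map_list_prod, map_list_prod, List.map_map, List.map_map]
    simp only [Function.comp_def, map_conj, map_comm, h1, h2]
    simp only [← hw, hl, ExtSq.act_wedge]
    group
  · rw [map_comm, map_comm, h1, h2, h3, h3, ← hw, ← map_comm, ExtSq.comm_hat_hat]
  · rw [map_pow, map_comm, h1, h2, h3, ← hw, ← map_pow, ExtSq.hat_comm]

end NuQ

/-! ### The group `τ^q(G)` -/

/-- If conjugation by `l k` induces the action of `k` for generators `k` of `G` and on generators of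
`G ∧^q G`, then it does so everywhere. -/
theorem conj_eq_map_act {q : ℕ} {G : Type*} [Group G] {n r : ℕ} {g : Fin n → G}
    (hg : Function.Surjective (FreeGroup.lift g)) {ω : Fin r → ExtSq q G}
    (hω : Function.Surjective (FreeGroup.lift ω)) {K : Type*} [Group K] (l : G →* K)
    (μ : ExtSq q G →* K) (h : ∀ i j, conj (μ (ω i)) (l (g j)) = μ (ExtSq.act q (g j) (ω i)))
    (x : ExtSq q G) (k : G) : conj (μ x) (l k) = μ (ExtSq.act q k x) := by
  -- The condition must range over all `x`: closure under products applies it to `act q a x`, and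
  -- closure under inverses to `act q a⁻¹ x`.
  let S : Subgroup G :=
    { carrier := {k | ∀ x, conj (μ x) (l k) = μ (ExtSq.act q k x)}
      one_mem' x := by rw [map_one, conj_one_right, ExtSq.act_one]
      mul_mem' := by
        intro a b ha hb x
        rw [map_mul, conj_mul_right, ha, hb, ExtSq.act_act]
      inv_mem' := by
        intro a ha x
        have := ha (ExtSq.act q a⁻¹ x)
        rw [ExtSq.act_act, inv_mul_cancel, ExtSq.act_one] at this
        rw [← this, ← conj_mul_right, ← map_mul, mul_inv_cancel, map_one, conj_one_right] }
  -- For a fixed generator of $G$ both sides are homomorphisms in `x`, so generators of $G\wedge^qG$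
  -- suffice.
  have hS : S = ⊤ := subgroup_eq_top_of_generators hg fun j x => by
    let c : K →* K := { toFun y := conj y (l (g j)), map_one' := conj_one_left _,
                        map_mul' a b := conj_mul' a b _ }
    have : c.comp μ = μ.comp (ExtSq.act q (g j)) := hom_eq_of_generators hω fun i => h i j
    exact DFunLike.congr_fun this x
  exact (hS ▸ Subgroup.mem_top k : k ∈ S) x

/-- Both sides obey the same crossed expansion rules in each variable, so agreement on generators
propagates, in the second variable and then in the first. Inverses are reached by expanding
$b^{-1}b=1$ and cancelling. -/
theorem map_wedge_eq_comm {q : ℕ} {G : Type*} [Group G] {n : ℕ} {g : Fin n → G}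
    (hg : Function.Surjective (FreeGroup.lift g)) {K : Type*} [Group K] (l r : G →* K)
    (μ : ExtSq q G →* K) (hl : ∀ x k, conj (μ x) (l k) = μ (ExtSq.act q k x))
    (hr : ∀ x k, conj (μ x) (r k) = μ (ExtSq.act q k x))
    (h : ∀ i j, μ (ExtSq.wedge q (g i) (g j)) = comm (l (g i)) (r (g j))) (a b : G) :
    μ (ExtSq.wedge q a b) = comm (l a) (r b) := by
  have mul_right (a b c : G) : μ (ExtSq.wedge q a (b * c)) =
      μ (ExtSq.wedge q a c) * conj (μ (ExtSq.wedge q a b)) (r c) := by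
    rw [ExtSq.wedge_mul_right, map_mul, hr, ExtSq.act_wedge]
  have mul_left (a b c : G) : μ (ExtSq.wedge q (a * b) c) =
      conj (μ (ExtSq.wedge q a c)) (l b) * μ (ExtSq.wedge q b c) := by
    rw [ExtSq.wedge_mul_left, map_mul, hl, ExtSq.act_wedge]
  have one_right (a : G) : μ (ExtSq.wedge q a 1) = 1 := by
    have := mul_right a 1 1
    rwa [mul_one, map_one, conj_one_right, left_eq_mul] at this
  have one_left (a : G) : μ (ExtSq.wedge q 1 a) = 1 := by
    have := mul_left 1 1 a
    rwa [mul_one, map_one, conj_one_right, left_eq_mul] at this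
  have conj_injective {x y k : K} (h : conj x k = conj y k) : x = y := by
    simpa [conj] using h
  have step (i : Fin n) (b : G) : μ (ExtSq.wedge q (g i) b) = comm (l (g i)) (r b) := by
    let S : Subgroup G :=
      { carrier := {b | μ (ExtSq.wedge q (g i) b) = comm (l (g i)) (r b)}
        one_mem' := by rw [Set.mem_ofPred_eq, one_right, map_one, comm_one_right]
        mul_mem' := by
          intro b c hb hc
          rw [Set.mem_ofPred_eq, mul_right, comm_map_mul_right, hb, hc]
        inv_mem' := by
          intro b hb
          have h1 := mul_right (g i) b⁻¹ b
          have h2 := comm_map_mul_right l r (g i) b⁻¹ b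
          rw [inv_mul_cancel, one_right, hb] at h1
          rw [inv_mul_cancel, map_one r, comm_one_right, h1] at h2
          exact conj_injective (mul_left_cancel h2) }
    have hS : S = ⊤ := subgroup_eq_top_of_generators hg (h i)
    exact (hS ▸ Subgroup.mem_top b : b ∈ S)
  let S : Subgroup G :=
    { carrier := {a | ∀ b, μ (ExtSq.wedge q a b) = comm (l a) (r b)}
      one_mem' b := by rw [one_left, map_one, comm_one_left]
      mul_mem' := by
        intro a c ha hc b
        rw [mul_left, comm_map_mul_left, ha, hc]
      inv_mem' := by
        intro a ha b
        have h1 := mul_left a⁻¹ a b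
        have h2 := comm_map_mul_left l r a⁻¹ a b
        rw [inv_mul_cancel, one_left, ha] at h1
        rw [inv_mul_cancel, map_one l, comm_one_left, h1] at h2
        exact conj_injective (mul_right_cancel h2) }
  have hS : S = ⊤ := subgroup_eq_top_of_generators hg step
  exact (hS ▸ Subgroup.mem_top a : a ∈ S) b

namespace Tau

variable {q : ℕ} {G : Type*} [Group G] {n r : ℕ} {P : PcData n} {g : Fin n → G}
  {U : PcData r} {ω : Fin r → ExtSq q G} {word : ExtSq q G → FreeGroup (Fin r)}

theorem mk_eq_one {x : FreeGroup (TauGen n r)} (hx : TauRel q P g U ω word x) :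
    PresentedGroup.mk {x | TauRel q P g U ω word x} x = 1 :=
  PresentedGroup.one_of_mem hx

/-- The natural maps from `ν^q(G)` and `G ∧^q G` to `τ^q(G)`. -/
theorem exists_hom_of_nuQ (hP : IsConsistentPcPresentation P g)
    (hU : IsConsistentPcPresentation U ω) (hword : ∀ x, FreeGroup.lift ω (word x) = x) :
    ∃ (Ψ : NuQ q G →* Tau q P g U ω word) (μ : ExtSq q G →* Tau q P g U ω word),
      (∀ i, Ψ (NuQ.left q (g i)) = PresentedGroup.of (TauGen.g i)) ∧
      (∀ i, Ψ (NuQ.right q (g i)) = PresentedGroup.of (TauGen.gφ i)) ∧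
      (∀ v, μ (FreeGroup.lift ω v) = PresentedGroup.mk _ (FreeGroup.map TauGen.w v)) ∧
      (∀ a b, Ψ (comm (NuQ.left q a) (NuQ.right q b)) = μ (ExtSq.wedge q a b)) ∧
      ∀ (hq : 1 ≤ q) k, Ψ (NuQ.hat hq k) = μ (ExtSq.hat hq k) := by
  let π := PresentedGroup.mk {x | TauRel q P g U ω word x}
  obtain ⟨l, hl⟩ := exists_hom_of_presentation hP.generates hP.relations
    (π.comp (FreeGroup.map TauGen.g)) fun x hx => mk_eq_one (TauRel.rel_g x hx)
  obtain ⟨ρ, hρ⟩ := exists_hom_of_presentation hP.generates hP.relations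
    (π.comp (FreeGroup.map TauGen.gφ)) fun x hx => mk_eq_one (TauRel.rel_gφ x hx)
  obtain ⟨μ, hμ⟩ := exists_hom_of_presentation hU.generates hU.relations
    (π.comp (FreeGroup.map TauGen.w)) fun x hx => mk_eq_one (TauRel.rel_w x hx)
  have hl' (i : Fin n) : l (g i) = π (FreeGroup.of (TauGen.g i)) := by
    simpa using hl (FreeGroup.of i)
  have hρ' (i : Fin n) : ρ (g i) = π (FreeGroup.of (TauGen.gφ i)) := by
    simpa using hρ (FreeGroup.of i)
  have hμ' (i : Fin r) : μ (ω i) = π (FreeGroup.of (TauGen.w i)) := by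
    simpa using hμ (FreeGroup.of i)
  -- The chosen words enter only through the elements they express.
  have hμw (x : ExtSq q G) : μ x = π (FreeGroup.map TauGen.w (word x)) := by
    rw [← MonoidHom.comp_apply, ← hμ, hword]
  have hcl := conj_eq_map_act hP.generates hU.generates l μ fun i j => by
    have h := mk_eq_one (TauRel.conj_w (q := q) (P := P) (g := g) (U := U) (ω := ω)
      (word := word) i j)
    rw [map_mul, map_inv, mul_inv_eq_one, ← conj.eq_1, map_conj] at h
    rw [hl', hμ', hμw]
    exact h
  have hcr := conj_eq_map_act hP.generates hU.generates ρ μ fun i j => by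
    have h := mk_eq_one (TauRel.conjφ_w (q := q) (P := P) (g := g) (U := U) (ω := ω)
      (word := word) i j)
    rw [map_mul, map_inv, mul_inv_eq_one, ← conj.eq_1, map_conj] at h
    rw [hρ', hμ', hμw]
    exact h
  have hw := map_wedge_eq_comm hP.generates l ρ μ hcl hcr fun i j => by
    have h := mk_eq_one (TauRel.conj_gφ (q := q) (P := P) (g := g) (U := U) (ω := ω)
      (word := word) i j)
    rw [map_mul, map_inv, mul_inv_eq_one] at h
    simp only [map_mul, map_inv] at h
    change (π _)⁻¹ * π _ * π _ = π _ * (π _)⁻¹ at h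
    rw [← hμw, ← hl', ← hρ'] at h
    -- Relation (4) reads $(g_i\wedge g_j)^{-1}=(g_j^\varphi)^{-1}g_i^{-1}g_j^\varphi
    -- g_i=[g_i,g_j^\varphi]^{-1}$.
    rw [← inv_inj, comm, ← mul_right_inj (ρ (g j)), ← h]
    group
  obtain ⟨Ψ, h1, h2, h3⟩ := NuQ.exists_hom_of_compatible l ρ μ hw hcl hcr
  refine ⟨Ψ, μ, fun i => (h1 _).trans (hl' i), fun i => (h2 _).trans (hρ' i), hμ,
    fun a b => ?_, h3⟩
  rw [map_comm, h1, h2, hw]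

/-- For a `q`-perfect group, the natural map from `τ^q(G)` to `ν^q(G)`. -/
theorem exists_hom_to_nuQ (hP : IsConsistentPcPresentation P g)
    (hU : IsConsistentPcPresentation U ω) (hword : ∀ x, FreeGroup.lift ω (word x) = x)
    {ψ : ExtSq q G →* NuQ q G}
    (hw : ∀ a b, ψ (ExtSq.wedge q a b) = comm (NuQ.left q a) (NuQ.right q b))
    (hh : ∀ (hq : 1 ≤ q) k, ψ (ExtSq.hat hq k) = NuQ.hat hq k) :
    ∃ Φ : Tau q P g U ω word →* NuQ q G,
      (∀ i, Φ (PresentedGroup.of (TauGen.g i)) = NuQ.left q (g i)) ∧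
      (∀ i, Φ (PresentedGroup.of (TauGen.gφ i)) = NuQ.right q (g i)) ∧
      ∀ v, Φ (PresentedGroup.mk _ (FreeGroup.map TauGen.w v)) = ψ (FreeGroup.lift ω v) := by
  have hp := NuQ.isNuPair q G
  have hcl (x : ExtSq q G) (k : G) : conj (ψ x) (NuQ.left q k) = ψ (ExtSq.act q k x) := by
    let c : NuQ q G →* NuQ q G :=
      { toFun y := conj y (NuQ.left q k), map_one' := conj_one_left _,
        map_mul' a b := conj_mul' a b _ }
    -- Conjugation is an endomorphism, so it suffices to compare on $a\wedge b$ and $\widehat a$.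
    have : c.comp ψ = ψ.comp (ExtSq.act q k) := ExtSq.hom_ext
      (fun a b => by
        change conj (ψ _) _ = ψ (ExtSq.act q k _)
        rw [ExtSq.act_wedge, hw, hw, hp.conj_left])
      (fun hq a => by
        change conj (ψ _) _ = ψ (ExtSq.act q k _)
        rw [ExtSq.act_hat, hh, hh, NuQ.conj_hat_left])
    exact DFunLike.congr_fun this x
  have hcr (x : ExtSq q G) (k : G) : conj (ψ x) (NuQ.right q k) = ψ (ExtSq.act q k x) := by
    let c : NuQ q G →* NuQ q G :=
      { toFun y := conj y (NuQ.right q k), map_one' := conj_one_left _,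
        map_mul' a b := conj_mul' a b _ }
    have : c.comp ψ = ψ.comp (ExtSq.act q k) := ExtSq.hom_ext
      (fun a b => by
        change conj (ψ _) _ = ψ (ExtSq.act q k _)
        rw [ExtSq.act_wedge, hw, hw, hp.conj_right])
      (fun hq a => by
        change conj (ψ _) _ = ψ (ExtSq.act q k _)
        rw [ExtSq.act_hat, hh, hh, NuQ.conj_hat_right])
    exact DFunLike.congr_fun this x
  let f : TauGen n r → NuQ q G
    | .g i => NuQ.left q (g i)
    | .gφ i => NuQ.right q (g i)
    | .w j => ψ (ω j)
  have eg (v : FreeGroup (Fin n)) :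
      FreeGroup.lift f (FreeGroup.map TauGen.g v) = NuQ.left q (FreeGroup.lift g v) := by
    have : (FreeGroup.lift f).comp (FreeGroup.map TauGen.g) =
        (NuQ.left q).comp (FreeGroup.lift g) := by ext i; simp [f]
    exact DFunLike.congr_fun this v
  have eφ (v : FreeGroup (Fin n)) :
      FreeGroup.lift f (FreeGroup.map TauGen.gφ v) = NuQ.right q (FreeGroup.lift g v) := by
    have : (FreeGroup.lift f).comp (FreeGroup.map TauGen.gφ) =
        (NuQ.right q).comp (FreeGroup.lift g) := by ext i; simp [f]
    exact DFunLike.congr_fun this v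
  have ew (v : FreeGroup (Fin r)) :
      FreeGroup.lift f (FreeGroup.map TauGen.w v) = ψ (FreeGroup.lift ω v) := by
    have : (FreeGroup.lift f).comp (FreeGroup.map TauGen.w) =
        ψ.comp (FreeGroup.lift ω) := by ext i; simp [f]
    exact DFunLike.congr_fun this v
  have lg (i : Fin n) : FreeGroup.lift f (FreeGroup.of (TauGen.g i)) = NuQ.left q (g i) :=
    FreeGroup.lift_apply_of
  have lφ (i : Fin n) : FreeGroup.lift f (FreeGroup.of (TauGen.gφ i)) = NuQ.right q (g i) :=
    FreeGroup.lift_apply_of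
  have lw (i : Fin r) : FreeGroup.lift f (FreeGroup.of (TauGen.w i)) = ψ (ω i) :=
    FreeGroup.lift_apply_of
  have relP {x : FreeGroup (Fin n)} (hx : P.Rel x) : FreeGroup.lift g x = 1 := by
    rw [← MonoidHom.mem_ker, hP.relations]
    exact Subgroup.subset_normalClosure hx
  have relU {x : FreeGroup (Fin r)} (hx : U.Rel x) : FreeGroup.lift ω x = 1 := by
    rw [← MonoidHom.mem_ker, hU.relations]
    exact Subgroup.subset_normalClosure hx
  have hrel : ∀ x ∈ {x | TauRel q P g U ω word x}, FreeGroup.lift f x = 1 := by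
    rintro x (⟨x, hx⟩ | ⟨x, hx⟩ | ⟨x, hx⟩ | ⟨i, j⟩ | ⟨i, j, -⟩ | ⟨i, j⟩ | ⟨i, j, -⟩ | ⟨i, j⟩ |
      ⟨i, j, -⟩)
    · rw [eg, relP hx, map_one]
    · rw [eφ, relP hx, map_one]
    · rw [ew, relU hx, map_one]
    · simp only [map_mul, map_inv, ew, lg, lφ, hword, hw, comm]
      group
    · simp only [map_mul, map_inv, ew, lg, lφ, hword, hw, comm]
      group
    · simp only [map_mul, map_inv, ew, lg, lw, hword, ← hcl, conj]
      group
    · simp only [map_mul, map_inv, ew, lg, lw, hword, ← hcl, conj]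
      group
    · simp only [map_mul, map_inv, ew, lφ, lw, hword, ← hcr, conj]
      group
    · simp only [map_mul, map_inv, ew, lφ, lw, hword, ← hcr, conj]
      group
  exact ⟨PresentedGroup.toGroup hrel, lg, lφ, ew⟩

end Tau

end QTensor

/-! ### The two natural maps are mutually inverse. -/

theorem mainTheorem5 {G : Type*} [Group G] (q : ℕ)
    -- a consistent polycyclic presentation of `G` in the generators `g_1, ..., g_n`
    {n : ℕ} (P : QTensor.PcData n) (g : Fin n → G)
    (hP : QTensor.IsConsistentPcPresentation P g)
    -- a consistent polycyclic presentation of `G ∧^q G` in the generators `ω_1, ..., ω_r`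
    {r : ℕ} (U : QTensor.PcData r) (ω : Fin r → QTensor.ExtSq q G)
    (hU : QTensor.IsConsistentPcPresentation U ω)
    -- any choice of words in the generators that express the elements of `G ∧^q G`
    (word : QTensor.ExtSq q G → FreeGroup (Fin r))
    (hword : ∀ x, FreeGroup.lift ω (word x) = x)
    (hG : QTensor.IsQPerfect q G) :
    ∃ Φ : QTensor.Tau q P g U ω word ≃* QTensor.NuQ q G,
      (∀ i, Φ (PresentedGroup.of (QTensor.TauGen.g i)) = QTensor.NuQ.left q (g i)) ∧
      (∀ i, Φ (PresentedGroup.of (QTensor.TauGen.gφ i)) = QTensor.NuQ.right q (g i)) ∧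
      -- a word in the `w_j` that expresses `a ∧ b` (or `k̂`) is sent to `[a, b^φ]` (or `k̂`)
      (∀ (v : FreeGroup (Fin r)) (a b : G), FreeGroup.lift ω v = QTensor.ExtSq.wedge q a b →
        Φ (PresentedGroup.mk _ (FreeGroup.map QTensor.TauGen.w v)) =
          QTensor.comm (QTensor.NuQ.left q a) (QTensor.NuQ.right q b)) ∧
      (∀ (v : FreeGroup (Fin r)) (hq : 1 ≤ q) (k : G),
        FreeGroup.lift ω v = QTensor.ExtSq.hat hq k →
        Φ (PresentedGroup.mk _ (FreeGroup.map QTensor.TauGen.w v)) = QTensor.NuQ.hat hq k) := by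
  obtain ⟨ψ, hw, hh⟩ := QTensor.NuQ.exists_hom_of_extSq hG
  obtain ⟨Ψ, μ, h1, h2, h3, h4, h5⟩ := QTensor.Tau.exists_hom_of_nuQ hP hU hword
  obtain ⟨Φ, k1, k2, k3⟩ := QTensor.Tau.exists_hom_to_nuQ hP hU hword hw hh
  -- `Ψ` and `Φ` interchange the two images of $G\wedge^qG$, which settles the generators $w_j$ and
  -- $\widehat k$.
  have hμ : Ψ.comp ψ = μ := QTensor.ExtSq.hom_ext
    (fun a b => by rw [MonoidHom.comp_apply, hw, h4])
    (fun hq k => by rw [MonoidHom.comp_apply, hh, h5])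
  have hψ (x : QTensor.ExtSq q G) : Φ (μ x) = ψ x := by
    obtain ⟨v, rfl⟩ := hU.generates x
    rw [h3, k3]
  have left_inv : Ψ.comp Φ = MonoidHom.id _ := by
    apply PresentedGroup.ext
    rintro (i | i | j)
    · exact (congrArg Ψ (k1 i)).trans (h1 i)
    · exact (congrArg Ψ (k2 i)).trans (h2 i)
    · have e := k3 (FreeGroup.of j)
      have e' := h3 (FreeGroup.of j)
      rw [FreeGroup.map.of] at e e'
      refine (congrArg Ψ e).trans ?_
      rw [← MonoidHom.comp_apply, hμ, e']
      rfl
  have right_inv : Φ.comp Ψ = MonoidHom.id _ := by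
    refine QTensor.NuQ.hom_ext (QTensor.hom_eq_of_generators hP.generates fun i => ?_)
      (QTensor.hom_eq_of_generators hP.generates fun i => ?_) fun hq k => ?_
    · exact (congrArg Φ (h1 i)).trans (k1 i)
    · exact (congrArg Φ (h2 i)).trans (k2 i)
    · rw [MonoidHom.comp_apply, h5, hψ, hh, MonoidHom.id_apply]
  exact ⟨MonoidHom.toMulEquiv Φ Ψ left_inv right_inv, k1, k2,
    fun v a b hv => (k3 v).trans (by rw [hv, hw]),
    fun v hq k hv => (k3 v).trans (by rw [hv, hh])⟩
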